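/- Let $\mathfrak A$ be a $C^*$-algebra, $H$ a Hilbert $\mathfrak A$-module, and $\mathcal L(H,K)$ the space of adjointable operators from $H$ to a Hilbert $\mathfrak A$-module $K$, with $\mathcal L(H)=\mathcal L(H,H)$, a unital $C^*$-algebra. Write $\mathcal R(T)$ and $\mathcal N(T)$ for the range and the null space of an operator $T$. A projection is a self-adjoint idempotent. A pair $(P,Q)$ in $\mathcal L(H)$ is a quasi-projection pair if $P$ is a projection, $Q$ is an idempotent, and $$PQ^*P=PQP,\quad PQ^*(I-P)=-PQ(I-P),\quad (I-P)Q^*(I-P)=(I-P)Q(I-P).$$ Put $$H_1=\mathcal R(P)\cap\mathcal R(Q),\quad H_2=\mathcal R(P)\cap\mathcal N(Q),\quad H_3=\mathcal N(P)\cap\mathcal R(Q),\quad H_4=\mathcal N(P)\cap\mathcal N(Q),$$ $$H_5=\overline{\mathcal R(PQ(I-P))},\quad H_6=\overline{\mathcal R((I-P)QP)}.$$ The pair is harmonious if $H_5$ and $H_6$ are orthogonally complemented in $H$, where a closed submodule $M$ is orthogonally complemented if $H=M+M^\perp$; in that case $P_M$ denotes the projection of $H$ onto $M$. Theorem. Let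 $(P,Q)$ be a harmonious quasi-projection pair on $H$ with $P\neq 0$ and $P\ne I$. Then each $H_i$ is orthogonally complemented in $H$, and $$U_{P,Q}:H\to\bigoplus_{i=1}^6H_i,\qquad U_{P,Q}(x)=(P_{H_1}x,\dots,P_{H_6}x)^T,$$ is a unitary operator. Moreover, $H_5\ne\{0\}$ if and only if $H_6\neq\{0\}$, which occurs if and only if $Q\ne Q^*$. In this case $$U_{P,Q}PU_{P,Q}^*=I_{H_1}\oplus I_{H_2}\oplus 0_{H_3}\oplus 0_{H_4}\oplus I_{H_5}\oplus 0_{H_6},\qquad U_{P,Q}QU_{P,Q}^*=I_{H_1}\oplus 0_{H_2}\oplus I_{H_3}\oplus 0_{H_4}\oplus\widehat Q,$$ where $$\widehat Q=\begin{pmatrix}A&-\ell(A)U^*\\ U\ell(A)&U(I_{H_5}-A)U^*\end{pmatrix}\in\mathcal L(H_5\oplus H_6)$$ for some self-adjoint $A\in\mathcal L(H_5)$ with $A^2-A\ge0$ and $\overline{\mathcal R(A^2-A)}=H_5$ and some unitary operator $U\in\mathcal L(H_5,H_6)$; here $\ell(A)=(A^2-A)^{1/2}$ is the positive square root in $\mathcal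 L(H_5)$. -/

import Mathlib

open scoped WithCStarModule

noncomputable section

namespace HilbertMod

set_option linter.unusedSectionVars false

/-! Throughout, a Hilbert `A`-module is a complete `CStarModule A H` over a (possibly non-unital)
C⋆-algebra `A`. Mathlib writes the module action on the left, `⟪x, a • y⟫ = a * ⟪x, y⟫`; right
Hilbert modules over a C⋆-algebra `B` are the same thing as such modules over `A = Bᵐᵒᵖ`. -/

section Operators

variable {A : Type*} [NonUnitalCStarAlgebra A] [PartialOrder A] [StarOrderedRing A]
variable {H : Type*} [NormedAddCommGroup H] [NormedSpace ℂ H] [SMul A H] [CStarModule A H]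
variable {K : Type*} [NormedAddCommGroup K] [NormedSpace ℂ K] [SMul A K] [CStarModule A K]
variable {L : Type*} [NormedAddCommGroup L] [NormedSpace ℂ L] [SMul A L] [CStarModule A L]

variable (A H K) in
/-- The space `𝓛(H, K)` of adjointable operators from `H` to `K`: maps `T : H → K` for which there
is a map `T* : K → H` with `⟪T x, y⟫ = ⟪x, T* y⟫`. On Hilbert modules such maps are automatically
bounded, `ℂ`-linear and `A`-linear; the first two properties are recorded in the types. -/
structure Adjointable where
  toCLM : H →L[ℂ] K
  adjCLM : K →L[ℂ] H
  inner_adj : ∀ x y, inner A (toCLM x) y = inner A x (adjCLM y)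

namespace Adjointable

instance : CoeFun (Adjointable A H K) (fun _ => H → K) := ⟨fun T => T.toCLM⟩

theorem eq_of_inner {x y : H} (h : ∀ z : H, inner A z x = inner A z y) : x = y := by
  rw [← sub_eq_zero, ← CStarModule.inner_self (A := A), CStarModule.inner_sub_right, h, sub_self]

theorem toCLM_injective : Function.Injective (toCLM : Adjointable A H K → H →L[ℂ] K) := by
  rintro ⟨T, S, h⟩ ⟨T', S', h'⟩ (rfl : T = T')
  congr
  ext y
  exact eq_of_inner (A := A) fun z => by rw [← h, ← h']

/-- The adjoint `T*`. -/
def adjoint (T : Adjointable A H K) : Adjointable A K H where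
  toCLM := T.adjCLM
  adjCLM := T.toCLM
  inner_adj x y := by rw [← CStarModule.star_inner, ← T.inner_adj, CStarModule.star_inner]

/-- The composition `S T`. -/
def comp (S : Adjointable A K L) (T : Adjointable A H K) : Adjointable A H L where
  toCLM := S.toCLM.comp T.toCLM
  adjCLM := T.adjCLM.comp S.adjCLM
  inner_adj x y := by simp [S.inner_adj, T.inner_adj]

instance : Zero (Adjointable A H K) := ⟨⟨0, 0, by simp⟩⟩
instance : Add (Adjointable A H K) :=
  ⟨fun S T => ⟨S.toCLM + T.toCLM, S.adjCLM + T.adjCLM, by simp [S.inner_adj, T.inner_adj]⟩⟩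
instance : Neg (Adjointable A H K) :=
  ⟨fun T => ⟨-T.toCLM, -T.adjCLM, by simp [T.inner_adj]⟩⟩
instance : Sub (Adjointable A H K) :=
  ⟨fun S T => ⟨S.toCLM - T.toCLM, S.adjCLM - T.adjCLM, by simp [S.inner_adj, T.inner_adj]⟩⟩
instance : SMul ℂ (Adjointable A H K) :=
  ⟨fun c T => ⟨c • T.toCLM, star c • T.adjCLM, by simp [T.inner_adj]⟩⟩
instance : SMul ℕ (Adjointable A H K) :=
  ⟨fun n T => ⟨n • T.toCLM, n • T.adjCLM, fun x y => by
    simp [← Nat.cast_smul_eq_nsmul ℂ, T.inner_adj]⟩⟩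
instance : SMul ℤ (Adjointable A H K) :=
  ⟨fun n T => ⟨n • T.toCLM, n • T.adjCLM, fun x y => by
    simp [← Int.cast_smul_eq_zsmul ℂ, T.inner_adj]⟩⟩

instance : AddCommGroup (Adjointable A H K) :=
  toCLM_injective.addCommGroup toCLM rfl (fun _ _ => rfl) (fun _ => rfl) (fun _ _ => rfl)
    (fun _ _ => rfl) (fun _ _ => rfl)

instance : Module ℂ (Adjointable A H K) :=
  toCLM_injective.module ℂ ⟨⟨toCLM, rfl⟩, fun _ _ => rfl⟩ (fun _ _ => rfl)

instance : One (Adjointable A H H) := ⟨⟨.id ℂ H, .id ℂ H, fun _ _ => rfl⟩⟩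
instance : Mul (Adjointable A H H) := ⟨comp⟩

instance : Ring (Adjointable A H H) where
  __ := (inferInstance : AddCommGroup (Adjointable A H H))
  mul_assoc _ _ _ := rfl
  one_mul _ := rfl
  mul_one _ := rfl
  zero_mul _ := toCLM_injective (zero_mul _)
  mul_zero _ := toCLM_injective (mul_zero _)
  left_distrib _ _ _ := toCLM_injective (mul_add _ _ _)
  right_distrib _ _ _ := toCLM_injective (add_mul _ _ _)

instance : Algebra ℂ (Adjointable A H H) :=
  Algebra.ofModule (fun _ _ _ => toCLM_injective (smul_mul_assoc _ _ _))
    (fun _ _ _ => toCLM_injective (mul_smul_comm _ _ _))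

variable (A H) in
def toCLMHom : Adjointable A H H →ₐ[ℂ] (H →L[ℂ] H) :=
  AlgHom.ofLinearMap ⟨⟨toCLM, fun _ _ => rfl⟩, fun _ _ => rfl⟩ rfl (fun _ _ => rfl)

/-- The operator norm on `𝓛(H)`. -/
instance : NormedRing (Adjointable A H H) :=
  NormedRing.induced _ _ (toCLMHom A H) toCLM_injective

instance : NormedAlgebra ℂ (Adjointable A H H) :=
  NormedAlgebra.induced ℂ _ _ (toCLMHom A H)

instance : StarRing (Adjointable A H H) where
  star := adjoint
  star_involutive _ := rfl
  star_mul _ _ := rfl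
  star_add _ _ := rfl

instance : StarModule ℂ (Adjointable A H H) := ⟨fun _ _ => toCLM_injective rfl⟩

theorem norm_def (T : Adjointable A H H) : ‖T‖ = ‖T.toCLM‖ := rfl

theorem norm_mul_norm_le (T : Adjointable A H H) : ‖T‖ * ‖T‖ ≤ ‖star T * T‖ := by
  have h : ‖T‖ ≤ √‖star T * T‖ := by
    refine ContinuousLinearMap.opNorm_le_bound _ (by positivity) fun x => ?_
    refine le_of_sq_le_sq ?_ (by positivity)
    have e : ‖T x‖ ^ 2 = ‖inner A x ((star T * T) x)‖ := by
      rw [CStarModule.norm_sq_eq A]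
      exact congrArg norm (T.inner_adj x (T x))
    calc ‖T x‖ ^ 2 = ‖inner A x ((star T * T) x)‖ := e
      _ ≤ ‖x‖ * ‖(star T * T) x‖ := CStarModule.norm_inner_le H
      _ ≤ ‖x‖ * (‖star T * T‖ * ‖x‖) := by
        gcongr
        exact (star T * T).toCLM.le_opNorm x
      _ = (√‖star T * T‖ * ‖x‖) ^ 2 := by
        rw [mul_pow, Real.sq_sqrt (norm_nonneg _)]; ring
  calc ‖T‖ * ‖T‖ ≤ √‖star T * T‖ * √‖star T * T‖ := by gcongr
    _ = ‖star T * T‖ := Real.mul_self_sqrt (norm_nonneg _)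

instance : CStarRing (Adjointable A H H) := ⟨fun {T} => norm_mul_norm_le T⟩

instance [CompleteSpace H] : CompleteSpace (Adjointable A H H) := by
  refine Metric.complete_of_cauchySeq_tendsto fun u hu => ?_
  have h1 : CauchySeq fun n => (u n).toCLM := by
    rw [Metric.cauchySeq_iff'] at hu ⊢
    exact hu
  have h2 : CauchySeq fun n => (u n).adjCLM := by
    rw [Metric.cauchySeq_iff'] at hu ⊢
    intro ε hε
    obtain ⟨N, hN⟩ := hu ε hε
    refine ⟨N, fun n hn => ?_⟩
    have := hN n hn
    rw [dist_eq_norm, ← norm_star] at this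
    rw [dist_eq_norm]
    exact this
  obtain ⟨T, hT⟩ := cauchySeq_tendsto_of_complete h1
  obtain ⟨S, hS⟩ := cauchySeq_tendsto_of_complete h2
  refine ⟨⟨T, S, fun x y => ?_⟩, ?_⟩
  · have a : Filter.Tendsto (fun n => inner A ((u n).toCLM x) y) Filter.atTop
        (nhds (inner A (T x) y)) :=
      (CStarModule.continuous_inner.tendsto (T x, y)).comp
        (((ContinuousLinearMap.apply ℂ H x).continuous.tendsto T |>.comp hT).prodMk_nhds
          tendsto_const_nhds)
    have b : Filter.Tendsto (fun n => inner A x ((u n).adjCLM y)) Filter.atTop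
        (nhds (inner A x (S y))) :=
      (CStarModule.continuous_inner.tendsto (x, S y)).comp
        (tendsto_const_nhds.prodMk_nhds
          ((ContinuousLinearMap.apply ℂ H y).continuous.tendsto S |>.comp hS))
    simp only [(u _).inner_adj] at a
    exact tendsto_nhds_unique a b
  · rw [tendsto_iff_dist_tendsto_zero] at hT ⊢
    exact hT

/-- `𝓛(H)` is a unital C⋆-algebra. -/
instance [CompleteSpace H] : CStarAlgebra (Adjointable A H H) where

/-- The order of the C⋆-algebra `𝓛(H)`; `0 ≤ T` means that `T` is a positive element. -/
instance [CompleteSpace H] : PartialOrder (Adjointable A H H) := CStarAlgebra.spectralOrder _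

instance [CompleteSpace H] : StarOrderedRing (Adjointable A H H) :=
  CStarAlgebra.spectralOrderedRing _

/-- `ℓ(T) = (T² - T)^{1/2}`. -/
def ell [CompleteSpace H] (T : Adjointable A H H) : Adjointable A H H := CFC.sqrt (T ^ 2 - T)

/-- `U` is a unitary operator: `U* U = I` and `U U* = I`. -/
def IsUnitary (U : Adjointable A H K) : Prop := U.adjoint.comp U = 1 ∧ U.comp U.adjoint = 1

variable (T : Adjointable A H K)

theorem map_op_smul (a : A) (x : H) : T (a • x) = a • T x :=
  eq_of_inner (A := A) fun z => by
    have h := fun w : H => T.adjoint.inner_adj z w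
    change ∀ w : H, inner A (T.adjCLM z) w = inner A z (T.toCLM w) at h
    rw [← h, CStarModule.inner_op_smul_right, CStarModule.inner_op_smul_right, h]

end Adjointable

theorem continuous_op_smul (a : A) : Continuous fun x : H => a • x := by
  let f : H →ₗ[ℂ] H :=
    { toFun := fun x => a • x
      map_add' := fun x y => Adjointable.eq_of_inner (A := A) fun z => by simp [mul_add]
      map_smul' := fun c x => Adjointable.eq_of_inner (A := A) fun z => by simp [mul_smul_comm] }
  refine (f.mkContinuous ‖a‖ fun x => ?_).continuous
  refine le_of_sq_le_sq ?_ (by positivity)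
  change ‖a • x‖ ^ 2 ≤ _
  rw [CStarModule.norm_sq_eq A, CStarModule.inner_op_smul_right, CStarModule.inner_op_smul_left]
  calc ‖a * (inner A x x * star a)‖ ≤ ‖a‖ * (‖inner A x x‖ * ‖star a‖) :=
        (norm_mul_le _ _).trans (by gcongr; exact norm_mul_le _ _)
    _ = (‖a‖ * ‖x‖) ^ 2 := by rw [norm_star, ← CStarModule.norm_sq_eq A]; ring

variable (A H) in
/-- Closed submodules of the Hilbert module `H`. -/
structure ClosedSub extends Submodule ℂ H where
  op_smul_mem : ∀ (a : A) {x : H}, x ∈ carrier → a • x ∈ carrier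
  isClosed : IsClosed carrier

namespace ClosedSub

instance : CoeSort (ClosedSub A H) (Type _) := ⟨fun M => M.toSubmodule⟩

variable (M : ClosedSub A H)

instance : SMul A M.toSubmodule := ⟨fun a x => ⟨a • (x : H), M.op_smul_mem a x.2⟩⟩

instance [CompleteSpace H] : CompleteSpace M.toSubmodule := M.isClosed.completeSpace_coe

/-- A closed submodule is a Hilbert module with the restricted inner product. -/
instance : CStarModule A M.toSubmodule where
  inner x y := inner A (x : H) (y : H)
  inner_add_right := by simp
  inner_self_nonneg := CStarModule.inner_self_nonneg
  inner_self {x} := by rw [CStarModule.inner_self, Submodule.coe_eq_zero]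
  inner_op_smul_right := CStarModule.inner_op_smul_right
  inner_smul_right_complex := by simp
  star_inner x y := CStarModule.star_inner _ _
  norm_eq_sqrt_norm_inner_self x := CStarModule.norm_eq_sqrt_norm_inner_self (A := A) (x : H)

/-- `M^⊥ = {x ∈ H : ⟪x, y⟫ = 0 for every y ∈ M}`. -/
def orthogonal : Submodule ℂ H where
  carrier := {x | ∀ y ∈ M.toSubmodule, inner A x y = 0}
  zero_mem' := by simp
  add_mem' hx hy z hz := by simp [hx z hz, hy z hz]
  smul_mem' c x hx z hz := by simp [hx z hz]

/-- `M` is orthogonally complemented in `H`: `H = M + M^⊥`. -/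
def IsOrthComplemented : Prop := M.toSubmodule ⊔ M.orthogonal = ⊤

theorem exists_proj {M : ClosedSub A H} (hM : M.IsOrthComplemented) (x : H) :
    ∃ y : M.toSubmodule, ∀ z ∈ M.toSubmodule, inner A (x - y) z = 0 := by
  have hx : x ∈ M.toSubmodule ⊔ M.orthogonal := by rw [hM]; trivial
  obtain ⟨y, hy, w, hw, rfl⟩ := Submodule.mem_sup.1 hx
  exact ⟨⟨y, hy⟩, fun z hz => by simpa using hw z hz⟩

/-- The underlying map of the projection of `H` onto `M`. -/
def projFun {M : ClosedSub A H} (hM : M.IsOrthComplemented) (x : H) : M.toSubmodule :=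
  (exists_proj hM x).choose

theorem inner_projFun {M : ClosedSub A H} (hM : M.IsOrthComplemented) (x : H)
    (z : M.toSubmodule) : inner A (projFun hM x) z = inner A x (z : H) := by
  have := (exists_proj hM x).choose_spec z z.2
  rw [CStarModule.inner_sub_left, sub_eq_zero] at this
  exact this.symm

theorem inner_projFun' {M : ClosedSub A H} (hM : M.IsOrthComplemented) (x : H)
    (z : M.toSubmodule) : inner A z (projFun hM x) = inner A (z : H) x := by
  rw [← CStarModule.star_inner, inner_projFun, CStarModule.star_inner]

/-- The projection `P_M` of `H` onto `M`, as an element of `𝓛(H, M)`; its adjoint is the inclusion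
of `M` into `H`. -/
def proj {M : ClosedSub A H} (hM : M.IsOrthComplemented) : Adjointable A H M.toSubmodule where
  toCLM := LinearMap.mkContinuous
    { toFun := projFun hM
      map_add' := fun x y => Adjointable.eq_of_inner (A := A) fun z => by
        simp [inner_projFun']
      map_smul' := fun c x => Adjointable.eq_of_inner (A := A) fun z => by
        simp [inner_projFun'] } 1 fun x => by
    have h : ‖projFun hM x‖ ^ 2 ≤ ‖x‖ * ‖projFun hM x‖ := by
      rw [CStarModule.norm_sq_eq A, inner_projFun]
      exact CStarModule.norm_inner_le H
    rw [one_mul]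
    change ‖projFun hM x‖ ≤ ‖x‖
    by_contra! hlt
    nlinarith [norm_nonneg x, norm_nonneg (projFun hM x)]
  adjCLM := M.toSubmodule.subtypeL
  inner_adj x y := inner_projFun hM x y

/-- The closure of the range of an adjointable operator. -/
def closedRange (T : Adjointable A K H) : ClosedSub A H where
  toSubmodule := (LinearMap.range T.toCLM.toLinearMap).topologicalClosure
  op_smul_mem a x hx := by
    refine map_mem_closure (continuous_op_smul a) hx ?_
    rintro _ ⟨k, rfl⟩
    exact ⟨a • k, T.map_op_smul a k⟩
  isClosed := Submodule.isClosed_topologicalClosure _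

/-- The null space `𝓝(T)`. -/
def ker (T : Adjointable A H K) : ClosedSub A H where
  toSubmodule := LinearMap.ker T.toCLM.toLinearMap
  op_smul_mem a x hx := by
    have hx : T x = 0 := hx
    have h0 : a • (0 : K) = 0 := Adjointable.eq_of_inner (A := A) fun z => by simp
    exact (T.map_op_smul a x).trans (by rw [hx, h0])
  isClosed := T.toCLM.isClosed_ker

/-- The range `𝓡(T)` of an idempotent `T`, which is closed. -/
def range (T : Adjointable A H H) (hT : IsIdempotentElem T) : ClosedSub A H where
  toSubmodule := LinearMap.range T.toCLM.toLinearMap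
  op_smul_mem := by
    rintro a _ ⟨k, rfl⟩
    exact ⟨a • k, T.map_op_smul a k⟩
  isClosed := by
    have h : ((LinearMap.range T.toCLM.toLinearMap : Submodule ℂ H) : Set H) = {x | T x = x} := by
      ext x
      refine ⟨?_, fun hx => ⟨x, hx⟩⟩
      rintro ⟨k, rfl⟩
      exact congrArg (fun S : Adjointable A H H => S k) hT
    change IsClosed ((LinearMap.range T.toCLM.toLinearMap : Submodule ℂ H) : Set H)
    rw [h]
    exact isClosed_eq T.toCLM.continuous continuous_id

/-- The intersection of two closed submodules. -/
def inf (M N : ClosedSub A H) : ClosedSub A H where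
  toSubmodule := M.toSubmodule ⊓ N.toSubmodule
  op_smul_mem a _ hx := ⟨M.op_smul_mem a hx.1, N.op_smul_mem a hx.2⟩
  isClosed := M.isClosed.inter N.isClosed

end ClosedSub

section DirectSum

variable {ι : Type*} [Fintype ι]

/-- For orthogonally complemented closed submodules `M i`, the operator
`H → ⨁ M i`, `x ↦ (P_{M i} x)_i`. Its adjoint is `(x_i)_i ↦ ∑ i, x_i`. -/
def toDirectSum {M : ι → ClosedSub A H} (hM : ∀ i, (M i).IsOrthComplemented) :
    Adjointable A H C⋆ᵐᵒᵈ(A, Π i, (M i).toSubmodule) where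
  toCLM := ((WithCStarModule.equivL ℂ :
      C⋆ᵐᵒᵈ(A, Π i, (M i).toSubmodule) ≃L[ℂ] _).symm : _ →L[ℂ] _).comp
    (ContinuousLinearMap.pi fun i => (ClosedSub.proj (hM i)).toCLM)
  adjCLM := (∑ i, (M i).toSubmodule.subtypeL.comp (ContinuousLinearMap.proj i)).comp
    ((WithCStarModule.equivL ℂ :
      C⋆ᵐᵒᵈ(A, Π i, (M i).toSubmodule) ≃L[ℂ] _) : _ →L[ℂ] _)
  inner_adj x y := by
    change ∑ i, inner A (ClosedSub.proj (hM i) x) (y i)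
      = inner A x ((∑ i, (M i).toSubmodule.subtypeL.comp (ContinuousLinearMap.proj i))
          (WithCStarModule.equiv A _ y))
    simp only [_root_.sum_apply, CStarModule.inner_sum_right]
    exact Finset.sum_congr rfl fun i _ => (ClosedSub.proj (hM i)).inner_adj x (y i)

variable {E : ι → Type*} [∀ i, NormedAddCommGroup (E i)] [∀ i, NormedSpace ℂ (E i)]
  [∀ i, SMul A (E i)] [∀ i, CStarModule A (E i)]

/-- The operator on `⨁ E i` with block matrix `(T i j)`, that is,
`(x_j)_j ↦ (∑ j, T i j x_j)_i`. -/
def blockMatrix (T : ∀ i j, Adjointable A (E j) (E i)) :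
    Adjointable A C⋆ᵐᵒᵈ(A, Π i, E i) C⋆ᵐᵒᵈ(A, Π i, E i) where
  toCLM := ((WithCStarModule.equivL ℂ : C⋆ᵐᵒᵈ(A, Π i, E i) ≃L[ℂ] _).symm : _ →L[ℂ] _).comp
    ((ContinuousLinearMap.pi fun i => ∑ j, (T i j).toCLM.comp (ContinuousLinearMap.proj j)).comp
      ((WithCStarModule.equivL ℂ : C⋆ᵐᵒᵈ(A, Π i, E i) ≃L[ℂ] _) : _ →L[ℂ] _))
  adjCLM := ((WithCStarModule.equivL ℂ : C⋆ᵐᵒᵈ(A, Π i, E i) ≃L[ℂ] _).symm : _ →L[ℂ] _).comp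
    ((ContinuousLinearMap.pi fun j => ∑ i, (T i j).adjCLM.comp (ContinuousLinearMap.proj i)).comp
      ((WithCStarModule.equivL ℂ : C⋆ᵐᵒᵈ(A, Π i, E i) ≃L[ℂ] _) : _ →L[ℂ] _))
  inner_adj x y := by
    change ∑ i, inner A ((∑ j, (T i j).toCLM.comp (ContinuousLinearMap.proj j))
        (WithCStarModule.equiv A _ x)) (y i)
      = ∑ j, inner A (x j) ((∑ i, (T i j).adjCLM.comp (ContinuousLinearMap.proj i))
        (WithCStarModule.equiv A _ y))
    simp only [_root_.sum_apply, CStarModule.inner_sum_right,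
      CStarModule.inner_sum_left]
    rw [Finset.sum_comm]
    exact Finset.sum_congr rfl fun j _ => Finset.sum_congr rfl fun i _ =>
      (T i j).inner_adj (x j) (y i)

end DirectSum

end Operators

section QuasiProjectionPairs

variable {A : Type*} [NonUnitalCStarAlgebra A] [PartialOrder A] [StarOrderedRing A]
variable {H : Type*} [NormedAddCommGroup H] [NormedSpace ℂ H] [SMul A H] [CStarModule A H]

/-- `(P, Q)` is a quasi-projection pair on `H`. -/
structure IsQuasiProjectionPair (P Q : Adjointable A H H) : Prop where
  isStarProjection : IsStarProjection P
  isIdempotentElem : IsIdempotentElem Q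
  compress_left : P * star Q * P = P * Q * P
  off_diagonal : P * star Q * (1 - P) = -(P * Q * (1 - P))
  compress_right : (1 - P) * star Q * (1 - P) = (1 - P) * Q * (1 - P)

/-- `H₁ = 𝓡(P) ∩ 𝓡(Q)`. -/
def H₁ (P Q : Adjointable A H H) (hP : IsIdempotentElem P) (hQ : IsIdempotentElem Q) :
    ClosedSub A H := (ClosedSub.range P hP).inf (ClosedSub.range Q hQ)

/-- `H₂ = 𝓡(P) ∩ 𝓝(Q)`. -/
def H₂ (P Q : Adjointable A H H) (hP : IsIdempotentElem P) :
    ClosedSub A H := (ClosedSub.range P hP).inf (ClosedSub.ker Q)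

/-- `H₃ = 𝓝(P) ∩ 𝓡(Q)`. -/
def H₃ (P Q : Adjointable A H H) (hQ : IsIdempotentElem Q) :
    ClosedSub A H := (ClosedSub.ker P).inf (ClosedSub.range Q hQ)

/-- `H₄ = 𝓝(P) ∩ 𝓝(Q)`. -/
def H₄ (P Q : Adjointable A H H) : ClosedSub A H := (ClosedSub.ker P).inf (ClosedSub.ker Q)

/-- `H₅` is the closure of the range of `P Q (I - P)`. -/
def H₅ (P Q : Adjointable A H H) : ClosedSub A H := ClosedSub.closedRange (P * Q * (1 - P))

/-- `H₆` is the closure of the range of `(I - P) Q P`. -/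
def H₆ (P Q : Adjointable A H H) : ClosedSub A H := ClosedSub.closedRange ((1 - P) * Q * P)

/-- A quasi-projection pair is harmonious if `H₅` and `H₆` are orthogonally complemented. -/
structure IsHarmonious (P Q : Adjointable A H H) : Prop extends IsQuasiProjectionPair P Q where
  isOrthComplemented_H₅ : (H₅ P Q).IsOrthComplemented
  isOrthComplemented_H₆ : (H₆ P Q).IsOrthComplemented

/-- The family `H₁, …, H₆`, indexed by `0, …, 5`. -/
def sixSub (P Q : Adjointable A H H) (hP : IsIdempotentElem P) (hQ : IsIdempotentElem Q) :
    Fin 6 → ClosedSub A H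
  | 0 => H₁ P Q hP hQ
  | 1 => H₂ P Q hP
  | 2 => H₃ P Q hQ
  | 3 => H₄ P Q
  | 4 => H₅ P Q
  | 5 => H₆ P Q

variable (P Q : Adjointable A H H) (hP : IsIdempotentElem P) (hQ : IsIdempotentElem Q)

/-- The blocks of `I ⊕ I ⊕ 0 ⊕ 0 ⊕ I ⊕ 0`. -/
def blocksP : ∀ i j, Adjointable A (sixSub P Q hP hQ j).toSubmodule
    (sixSub P Q hP hQ i).toSubmodule
  | 0, 0 => 1
  | 1, 1 => 1
  | 4, 4 => 1
  | _, _ => 0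

/-- The blocks of `I ⊕ 0 ⊕ I ⊕ 0 ⊕ Q̂`, where
`Q̂ = [[a, -ℓ(a) U*], [U ℓ(a), U (I - a) U*]]` on `H₅ ⊕ H₆`. -/
def blocksQ [CompleteSpace H] (a : Adjointable A (H₅ P Q).toSubmodule (H₅ P Q).toSubmodule)
    (U : Adjointable A (H₅ P Q).toSubmodule (H₆ P Q).toSubmodule) :
    ∀ i j, Adjointable A (sixSub P Q hP hQ j).toSubmodule (sixSub P Q hP hQ i).toSubmodule
  | 0, 0 => 1
  | 2, 2 => 1
  | 4, 4 => a
  | 4, 5 => (-a.ell).comp U.adjoint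
  | 5, 4 => U.comp a.ell
  | 5, 5 => U.comp ((1 - a).comp U.adjoint)
  | _, _ => 0

end QuasiProjectionPairs

end HilbertMod

end

open HilbertMod

noncomputable section

set_option linter.unusedSectionVars false

namespace HilbertMod

/-! Relative to `P`, the axioms say that `Q*` is `Q` with both off-diagonal blocks negated. So for
`T = PQ(1-P)` one has `T* = -(1-P)QP`, and `Q = Q*` exactly when these blocks vanish.

A vector of `𝓡(P)` orthogonal to `H₅` is killed by `T*`, so `Q` keeps it in `𝓡(P)` and it splits as
`Qu + (u - Qu)` in `H₁ + H₂`; symmetrically for `𝓝(P)`, `H₆` and `H₃ + H₄`. Harmony provides the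
projections that start this splitting (`sixSub_exists_sum`). Since the pieces are orthogonal
(`sixSub_inner_eq_zero`), they are complemented and their direct sum is unitarily `H`.

On `H₅ ⊕ H₆` the form of `Q` comes from the blocks of `Q² = Q`. Let `a` be the `H₅` corner and `c`
the corner from `H₅` to `H₆`. Then `c*c = a² - a`, which is `TT*` on `H₅`, so `c` and `ℓ(a)` have
the same Gram operator. Both have dense range, hence `c = U ℓ(a)` with `U` unitary
(`exists_isUnitary_comp_eq`), and the other blocks follow.

Closed ranges need not be complemented in Hilbert modules, so density is obtained not from kernels
but from `𝓡(T) ⊆ closure 𝓡(TT*)`, proved by functional calculus. -/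

theorem exists_norm_sub_mul_star_mul_sq_le {B : Type*} [CStarAlgebra B] (T : B) {ε : ℝ}
    (hε : 0 < ε) : ∃ S : B, ‖T - T * star T * S‖ ^ 2 ≤ ε := by
  let : PartialOrder B := CStarAlgebra.spectralOrder B
  have : StarOrderedRing B := CStarAlgebra.spectralOrderedRing B
  set x : B := star T * T with hx
  have hx0 : 0 ≤ x := star_mul_self_nonneg T
  have hsp : ∀ t ∈ spectrum ℝ x, 0 ≤ t := fun t ht => spectrum_nonneg_of_nonneg hx0 ht
  have hsa : IsSelfAdjoint x := .of_nonneg hx0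
  have hc : ContinuousOn (fun t : ℝ => (t + ε)⁻¹) (spectrum ℝ x) :=
    ContinuousOn.inv₀ (by fun_prop) fun t ht => by have := hsp t ht; positivity
  have hc' : ContinuousOn (fun t : ℝ => ε * (t + ε)⁻¹) (spectrum ℝ x) := by fun_prop
  set R : B := cfc (fun t : ℝ => ε * (t + ε)⁻¹) x with hR
  have hRs : star R = R := (cfc_predicate _ x : IsSelfAdjoint R)
  have hid : 1 - x * cfc (fun t : ℝ => (t + ε)⁻¹) x = R := by
    have e : x * cfc (fun t : ℝ => (t + ε)⁻¹) x = cfc (fun t : ℝ => t * (t + ε)⁻¹) x := by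
      rw [cfc_mul (fun t : ℝ => t) (fun t : ℝ => (t + ε)⁻¹) x (by fun_prop) hc, cfc_id' ℝ x]
    rw [e, ← cfc_one ℝ x, ← cfc_sub (fun t : ℝ => (1 : ℝ → ℝ) t) _ x (by fun_prop) (by fun_prop)]
    refine cfc_congr fun t ht => ?_
    have := hsp t ht
    have h2 : t + ε ≠ 0 := by positivity
    simp only [Pi.one_apply]
    field_simp
    ring
  have hmid : R * x * R = cfc (fun t : ℝ => ε * (t + ε)⁻¹ * t * (ε * (t + ε)⁻¹)) x := by
    rw [cfc_mul _ _ x (by fun_prop) hc', cfc_mul _ (fun t : ℝ => t) x hc' (by fun_prop),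
      cfc_id' ℝ x]
  -- The regularised choice `S = T(T*T + ε)⁻¹` leaves the error `TR` with `R = ε(T*T + ε)⁻¹`.
  refine ⟨T * cfc (fun t : ℝ => (t + ε)⁻¹) x, ?_⟩
  have e : T - T * star T * (T * cfc (fun t : ℝ => (t + ε)⁻¹) x) = T * R := by
    rw [← hid]
    generalize cfc (fun t : ℝ => (t + ε)⁻¹) x = G
    rw [hx]; noncomm_ring
  rw [e, sq, ← CStarRing.norm_star_mul_self]
  have e2 : star (T * R) * (T * R) = R * x * R := by
    rw [star_mul, hRs, hx]; noncomm_ring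
  rw [e2, hmid]
  refine norm_cfc_le hε.le fun t ht => ?_
  have h0 := hsp t ht
  have h2 : 0 < t + ε := by positivity
  rw [Real.norm_of_nonneg (by positivity)]
  have : ε * (t + ε)⁻¹ * t * (ε * (t + ε)⁻¹) = ε * ((ε * t) / (t + ε) ^ 2) := by
    field_simp
  rw [this]
  -- What remains is `εt ≤ (t + ε)²` for `t ≥ 0`.
  refine mul_le_of_le_one_right hε.le ((div_le_one (by positivity)).2 ?_)
  nlinarith

section

variable {A : Type*} [NonUnitalCStarAlgebra A] [PartialOrder A] [StarOrderedRing A]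
variable {H : Type*} [NormedAddCommGroup H] [NormedSpace ℂ H] [SMul A H] [CStarModule A H]
variable {K : Type*} [NormedAddCommGroup K] [NormedSpace ℂ K] [SMul A K] [CStarModule A K]
variable {L : Type*} [NormedAddCommGroup L] [NormedSpace ℂ L] [SMul A L] [CStarModule A L]

/-! ### Adjointable operators: dense ranges and unitaries -/

namespace Adjointable

@[ext]
theorem ext {S T : Adjointable A H K} (h : ∀ x, S x = T x) : S = T :=
  toCLM_injective (ContinuousLinearMap.ext h)

theorem inner_adjoint_right (T : Adjointable A H K) (x : H) (y : K) :
    inner A (T x) y = inner A x (T.adjoint y) := T.inner_adj x y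

theorem inner_adjoint_left (T : Adjointable A H K) (x : H) (y : K) :
    inner A y (T x) = inner A (T.adjoint y) x := (T.adjoint.inner_adj y x).symm

theorem inner_star_right (T : Adjointable A H H) (x y : H) :
    inner A (T x) y = inner A x ((star T) y) := T.inner_adj x y

theorem inner_star_left (T : Adjointable A H H) (x y : H) :
    inner A y (T x) = inner A ((star T) y) x := T.inner_adjoint_left x y

theorem one_apply (x : H) : (1 : Adjointable A H H) x = x := rfl
theorem comp_apply (S : Adjointable A K L) (T : Adjointable A H K) (x : H) :
    (S.comp T) x = S (T x) := rfl
theorem adjoint_comp (S : Adjointable A K L) (T : Adjointable A H K) :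
    (S.comp T).adjoint = T.adjoint.comp S.adjoint := rfl
theorem comp_assoc {M : Type*} [NormedAddCommGroup M] [NormedSpace ℂ M] [SMul A M]
    [CStarModule A M] (R : Adjointable A L M) (S : Adjointable A K L) (T : Adjointable A H K) :
    (R.comp S).comp T = R.comp (S.comp T) := rfl

/-- `T` is a norm limit of operators `TT*S`, so `Tx` is a limit of the vectors `TT*(Sx)`. -/
theorem apply_mem_closure_range_mul_star [CompleteSpace H] (T : Adjointable A H H) (x : H) :
    T x ∈ closure (Set.range (T * star T).toCLM) := by
  rw [Metric.mem_closure_iff]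
  intro ε hε
  set δ : ℝ := ε / (‖x‖ + 1) with hδ
  have hδ0 : 0 < δ := by positivity
  obtain ⟨S, hS⟩ := exists_norm_sub_mul_star_mul_sq_le T (ε := δ ^ 2) (by positivity)
  have hS' : ‖T - T * star T * S‖ ≤ δ := le_of_sq_le_sq hS hδ0.le
  refine ⟨_, ⟨S x, rfl⟩, ?_⟩
  rw [dist_eq_norm]
  calc ‖T x - (T * star T) (S x)‖ ≤ ‖T - T * star T * S‖ * ‖x‖ :=
        (T - T * star T * S).toCLM.le_opNorm x
    _ ≤ δ * ‖x‖ := by gcongr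
    _ < δ * (‖x‖ + 1) := by gcongr; linarith
    _ = ε := by rw [hδ]; field_simp

/-- Two operators with dense ranges and the same Gram form differ by a unitary. -/
theorem exists_isUnitary_comp_eq [CompleteSpace K] [CompleteSpace L] (S : Adjointable A H K)
    (T : Adjointable A H L) (hS : DenseRange S.toCLM) (hT : DenseRange T.toCLM)
    (h : S.adjoint.comp S = T.adjoint.comp T) :
    ∃ U : Adjointable A K L, U.IsUnitary ∧ U.comp S = T := by
  have hin : ∀ x y, inner A (S x) (S y) = inner A (T x) (T y) := fun x y => by
    rw [inner_adjoint_right, inner_adjoint_right]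
    exact congrArg (fun R : Adjointable A H H => inner A x (R y)) h
  have hn : ∀ x, ‖S x‖ = ‖T x‖ := fun x => by
    rw [CStarModule.norm_eq_sqrt_norm_inner_self (A := A), hin,
      ← CStarModule.norm_eq_sqrt_norm_inner_self]
  -- Equal Gram forms make `Sx ↦ Tx` and its inverse isometric; both extend by continuity, and the
  -- second extension is the adjoint of the first.
  let V : K →L[ℂ] L := T.toCLM.toLinearMap.extendOfNorm S.toCLM.toLinearMap
  let W : L →L[ℂ] K := S.toCLM.toLinearMap.extendOfNorm T.toCLM.toLinearMap
  have hV : ∀ x, V (S x) = T x := fun x =>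
    LinearMap.extendOfNorm_eq hS ⟨1, fun x => by rw [one_mul]; exact (hn x).ge⟩ x
  have hW : ∀ x, W (T x) = S x := fun x =>
    LinearMap.extendOfNorm_eq hT ⟨1, fun x => by rw [one_mul]; exact (hn x).le⟩ x
  refine ⟨⟨V, W, fun x y => ?_⟩, ⟨ext fun x => ?_, ext fun y => ?_⟩, ext hV⟩
  · refine hS.induction_on (p := fun x => inner A (V x) y = inner A x (W y)) x
      (isClosed_eq (CStarModule.continuous_inner.comp (V.continuous.prodMk continuous_const))
        (CStarModule.continuous_inner.comp (continuous_id.prodMk continuous_const))) fun x => ?_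
    refine hT.induction_on (p := fun y => inner A (V (S x)) y = inner A (S x) (W y)) y
      (isClosed_eq (CStarModule.continuous_inner.comp (continuous_const.prodMk continuous_id))
        (CStarModule.continuous_inner.comp (continuous_const.prodMk W.continuous))) fun y => ?_
    rw [hV, hW, hin]
  · refine hS.induction_on (p := fun x => W (V x) = x) x
      (isClosed_eq (W.continuous.comp V.continuous) continuous_id) fun x => ?_
    rw [hV, hW]
  · refine hT.induction_on (p := fun x => V (W x) = x) y
      (isClosed_eq (V.continuous.comp W.continuous) continuous_id) fun x => ?_
    rw [hW, hV]

end Adjointable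

/-! ### Projections, closed ranges and compressions -/

namespace ClosedSub

open Adjointable

variable {M N : ClosedSub A H}

theorem proj_eq_of_forall_inner (hM : M.IsOrthComplemented) {x : H} {y : M.toSubmodule}
    (h : ∀ z : M.toSubmodule, inner A (z : H) x = inner A (z : H) (y : H)) : proj hM x = y :=
  eq_of_inner (A := A) fun z => (inner_projFun' hM x z).trans (h z)

theorem proj_coe (hM : M.IsOrthComplemented) (y : M.toSubmodule) : proj hM (y : H) = y :=
  proj_eq_of_forall_inner hM fun _ => rfl

theorem coe_proj_of_mem (hM : M.IsOrthComplemented) {x : H} (hx : x ∈ M.toSubmodule) :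
    (proj hM x : H) = x := congrArg Subtype.val (proj_coe hM ⟨x, hx⟩)

theorem proj_eq_zero (hM : M.IsOrthComplemented) {x : H}
    (h : ∀ z ∈ M.toSubmodule, inner A z x = 0) : proj hM x = 0 :=
  proj_eq_of_forall_inner hM fun z => by simpa using h z z.2

theorem inner_sub_proj (hM : M.IsOrthComplemented) (x : H) {z : H} (hz : z ∈ M.toSubmodule) :
    inner A z (x - proj hM x) = 0 := by
  rw [CStarModule.inner_sub_right, sub_eq_zero]
  exact (inner_projFun' hM x ⟨z, hz⟩).symm

theorem apply_mem_closedRange (T : Adjointable A K H) (x : K) :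
    T x ∈ (closedRange T).toSubmodule := subset_closure ⟨x, rfl⟩

theorem closedRange_induction {T : Adjointable A K H} {p : H → Prop} (hp : IsClosed {x | p x})
    (h : ∀ x, p (T x)) {y : H} (hy : y ∈ (closedRange T).toSubmodule) : p y := by
  refine closure_minimal (t := {x | p x}) ?_ hp hy
  rintro _ ⟨x, rfl⟩
  exact h x

theorem closedRange_eq_bot_iff {T : Adjointable A K H} :
    (closedRange T).toSubmodule = ⊥ ↔ T = 0 := by
  refine ⟨fun h => Adjointable.ext fun x => ?_, ?_⟩
  · have := apply_mem_closedRange T x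
    rw [h] at this
    exact this
  · rintro rfl
    refine (Submodule.eq_bot_iff _).2 fun y hy => ?_
    exact closedRange_induction (p := fun y => y = 0) isClosed_singleton (fun _ => rfl) hy

/-- An operator into `closedRange T` whose range contains that of `T T*` has dense range. -/
theorem denseRange_of_mul_star [CompleteSpace H] {T : Adjointable A H H} {E : Type*}
    (f : E → (closedRange T).toSubmodule) (h : ∀ x, ∃ e, (f e : H) = (T * star T) x) :
    DenseRange f := by
  intro y
  rw [closure_subtype]
  refine closedRange_induction (p := fun y => y ∈ closure (Subtype.val '' Set.range f))
    isClosed_closure (fun x => ?_) y.2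
  refine closure_mono ?_ (apply_mem_closure_range_mul_star T x)
  rintro _ ⟨z, rfl⟩
  obtain ⟨e, he⟩ := h z
  exact ⟨f e, ⟨e, rfl⟩, he⟩

/-- The compression of a positive operator `T` with range in `M` is positive. -/
theorem compress_nonneg [CompleteSpace H] (hM : M.IsOrthComplemented) {T : Adjointable A H H}
    (hT : 0 ≤ T) (hTM : ∀ x, T x ∈ M.toSubmodule) :
    0 ≤ (proj hM).comp (T.comp (proj hM).adjoint) := by
  set s := CFC.sqrt T with hs
  have hss : s * s = T := CFC.sqrt_mul_sqrt_self T hT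
  have hsa : star s = s := IsSelfAdjoint.of_nonneg (CFC.sqrt_nonneg T)
  set e : Adjointable A H H := (proj hM).adjoint.comp (proj hM) with he
  have hes : star e = e := rfl
  -- Positivity must be witnessed inside `𝓛(M)`, so the square root itself is compressed. This loses
  -- nothing: `eT = T` gives `(1-e)s²(1-e) = 0`, hence `es = s`.
  have h1 : s * (1 - e) = 0 := by
    rw [← CStarRing.star_mul_self_eq_zero_iff]
    have : e * T = T := Adjointable.ext fun x => coe_proj_of_mem hM (hTM x)
    rw [star_mul, star_sub, star_one, hes, hsa, mul_assoc, ← mul_assoc s, hss, ← mul_assoc,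
      sub_mul, one_mul, this, sub_self, zero_mul]
  have h2 : e * s = s := by
    have := congrArg star h1
    rw [star_mul, star_sub, star_one, hes, hsa, star_zero, sub_mul, one_mul, sub_eq_zero] at this
    exact this.symm
  have h3 : (proj hM).comp (T.comp (proj hM).adjoint) =
      star ((proj hM).comp (s.comp (proj hM).adjoint)) *
        ((proj hM).comp (s.comp (proj hM).adjoint)) := by
    have h4 : star ((proj hM).comp (s.comp (proj hM).adjoint)) =
        (proj hM).comp ((star s).comp (proj hM).adjoint) := rfl
    rw [h4, hsa]
    ext y
    change ((proj hM) (T y) : H) = proj hM (s ((e * s) (y : H)))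
    rw [h2, ← hss]
    rfl
  rw [h3]
  exact star_mul_self_nonneg _

end ClosedSub

/-! ### Orthogonal direct sums and block matrices -/

section DirectSum

open Adjointable

variable {ι : Type*} [Fintype ι] {M : ι → ClosedSub A H}

theorem toDirectSum_apply (hM : ∀ i, (M i).IsOrthComplemented) (x : H) (i : ι) :
    toDirectSum hM x i = ClosedSub.proj (hM i) x := rfl

theorem toDirectSum_adjoint_apply (hM : ∀ i, (M i).IsOrthComplemented)
    (y : C⋆ᵐᵒᵈ(A, Π i, (M i).toSubmodule)) :
    (toDirectSum hM).adjoint y = ∑ i, (y i : H) := by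
  change (∑ i, (M i).toSubmodule.subtypeL.comp (ContinuousLinearMap.proj i))
    (WithCStarModule.equiv A _ y) = _
  rw [_root_.sum_apply]
  rfl

theorem blockMatrix_apply {E : ι → Type*} [∀ i, NormedAddCommGroup (E i)]
    [∀ i, NormedSpace ℂ (E i)] [∀ i, SMul A (E i)] [∀ i, CStarModule A (E i)]
    (T : ∀ i j, Adjointable A (E j) (E i)) (x : C⋆ᵐᵒᵈ(A, Π i, E i)) (i : ι) :
    blockMatrix T x i = ∑ j, T i j (x j) := by
  change (∑ j, (T i j).toCLM.comp (ContinuousLinearMap.proj j)) (WithCStarModule.equiv A _ x) = _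
  rw [_root_.sum_apply]
  rfl

theorem toDirectSum_comp_comp_adjoint (hM : ∀ i, (M i).IsOrthComplemented)
    (T : Adjointable A H H) {B : ∀ i j, Adjointable A (M j).toSubmodule (M i).toSubmodule}
    (h : ∀ i j, (ClosedSub.proj (hM i)).comp (T.comp (ClosedSub.proj (hM j)).adjoint) = B i j) :
    (toDirectSum hM).comp (T.comp (toDirectSum hM).adjoint) = blockMatrix B := by
  refine Adjointable.ext fun x => WithCStarModule.ext fun i => ?_
  rw [blockMatrix_apply, comp_apply, comp_apply, toDirectSum_apply, toDirectSum_adjoint_apply,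
    map_sum, map_sum]
  exact Finset.sum_congr rfl fun j _ => congrArg (fun R : Adjointable A _ _ => R (x j)) (h i j)

theorem isOrthComplemented_of_sum {M : ι → ClosedSub A H}
    (horth : ∀ i j, i ≠ j → ∀ x ∈ (M i).toSubmodule, ∀ y ∈ (M j).toSubmodule, inner A x y = 0)
    (hsum : ∀ x : H, ∃ y : ∀ i, (M i).toSubmodule, x = ∑ i, (y i : H)) (i : ι) :
    (M i).IsOrthComplemented := by
  classical
  refine Submodule.eq_top_iff'.2 fun x => ?_
  obtain ⟨y, rfl⟩ := hsum x
  refine Submodule.sum_mem _ fun j _ => ?_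
  rcases eq_or_ne j i with rfl | hj
  · exact Submodule.mem_sup_left (y j).2
  · exact Submodule.mem_sup_right fun z hz => horth j i hj _ (y j).2 z hz

/-- By orthogonality each projection picks out its own summand of `∑ yⱼ`, so the summation map,
which is the adjoint, is a two-sided inverse. -/
theorem toDirectSum_isUnitary (hM : ∀ i, (M i).IsOrthComplemented)
    (horth : ∀ i j, i ≠ j → ∀ x ∈ (M i).toSubmodule, ∀ y ∈ (M j).toSubmodule, inner A x y = 0)
    (hsum : ∀ x : H, ∃ y : ∀ i, (M i).toSubmodule, x = ∑ i, (y i : H)) :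
    (toDirectSum hM).IsUnitary := by
  classical
  have key : ∀ (y : ∀ i, (M i).toSubmodule) i,
      ClosedSub.proj (hM i) (∑ j, (y j : H)) = y i := fun y i => by
    rw [map_sum, Finset.sum_eq_single i, ClosedSub.proj_coe]
    · exact fun j _ hj => ClosedSub.proj_eq_zero _ fun z hz => horth i j hj.symm z hz _ (y j).2
    · simp
  refine ⟨Adjointable.ext fun x => ?_, Adjointable.ext fun y => WithCStarModule.ext fun i => ?_⟩
  · obtain ⟨y, rfl⟩ := hsum x
    rw [comp_apply, toDirectSum_adjoint_apply]
    simp only [toDirectSum_apply, key, one_apply]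
  · rw [comp_apply, toDirectSum_adjoint_apply, toDirectSum_apply]
    exact key (fun j => y j) i

end DirectSum

end

section

variable {A : Type*} [NonUnitalCStarAlgebra A] [PartialOrder A] [StarOrderedRing A]
variable {H : Type*} [NormedAddCommGroup H] [NormedSpace ℂ H] [SMul A H] [CStarModule A H]

open Adjointable

namespace ClosedSub

variable {M N : ClosedSub A H}

theorem compress_eq_zero (hM : M.IsOrthComplemented) (hN : N.IsOrthComplemented)
    {T : Adjointable A H H} (h : ∀ z ∈ M.toSubmodule, ∀ y ∈ N.toSubmodule, inner A z (T y) = 0) :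
    (proj hM).comp (T.comp (proj hN).adjoint) = 0 :=
  Adjointable.ext fun y => proj_eq_zero hM fun z hz => h z hz y y.2

theorem compress_eq_one (hM : M.IsOrthComplemented) {T : Adjointable A H H}
    (h : ∀ y ∈ M.toSubmodule, T y = y) : (proj hM).comp (T.comp (proj hM).adjoint) = 1 :=
  Adjointable.ext fun y => (congrArg (proj hM) (h y y.2)).trans (proj_coe hM y)

theorem mem_range_iff {T : Adjointable A H H} (hT : IsIdempotentElem T) {x : H} :
    x ∈ (range T hT).toSubmodule ↔ T x = x := by
  refine ⟨?_, fun hx => ⟨x, hx⟩⟩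
  rintro ⟨k, rfl⟩
  exact congrArg (fun S : Adjointable A H H => S k) hT

end ClosedSub

section Membership

variable {P Q : Adjointable A H H} {hP : IsIdempotentElem P} {hQ : IsIdempotentElem Q} {x : H}

theorem mem_H₁ : x ∈ (H₁ P Q hP hQ).toSubmodule ↔ P x = x ∧ Q x = x :=
  and_congr (ClosedSub.mem_range_iff hP) (ClosedSub.mem_range_iff hQ)

theorem mem_H₂ : x ∈ (H₂ P Q hP).toSubmodule ↔ P x = x ∧ Q x = 0 :=
  and_congr (ClosedSub.mem_range_iff hP) Iff.rfl

theorem mem_H₃ : x ∈ (H₃ P Q hQ).toSubmodule ↔ P x = 0 ∧ Q x = x :=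
  and_congr Iff.rfl (ClosedSub.mem_range_iff hQ)

theorem mem_H₄ : x ∈ (H₄ P Q).toSubmodule ↔ P x = 0 ∧ Q x = 0 := Iff.rfl

end Membership

/-! ### Block algebra of a quasi-projection pair -/

namespace IsQuasiProjectionPair

variable {P Q : Adjointable A H H} (h : IsQuasiProjectionPair P Q)
include h

theorem star_left : star P = P := h.isStarProjection.isSelfAdjoint

theorem left_left (x : H) : P (P x) = P x :=
  congrArg (fun S : Adjointable A H H => S x) h.isStarProjection.isIdempotentElem

theorem right_right (x : H) : Q (Q x) = Q x :=
  congrArg (fun S : Adjointable A H H => S x) h.isIdempotentElem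

theorem inner_left (x y : H) : inner A (P x) y = inner A x (P y) := by
  rw [inner_star_right, h.star_left]

theorem off_diagonal' : (1 - P) * star Q * P = -((1 - P) * Q * P) := by
  have := congrArg star h.off_diagonal
  simp only [star_mul, star_neg, star_sub, star_one, star_star, h.star_left, ← mul_assoc] at this
  rw [this, neg_neg]

theorem star_upper : star (P * Q * (1 - P)) = -((1 - P) * Q * P) := by
  rw [← h.off_diagonal']
  simp only [star_mul, star_sub, star_one, h.star_left, mul_assoc]

theorem star_lower : star ((1 - P) * Q * P) = -(P * Q * (1 - P)) := by
  rw [← h.off_diagonal]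
  simp only [star_mul, star_sub, star_one, h.star_left, mul_assoc]

/-- The sign rule behind everything else: the adjoint keeps the diagonal blocks and negates the
off-diagonal ones. -/
theorem star_right : star Q =
    P * Q * P - P * Q * (1 - P) - (1 - P) * Q * P + (1 - P) * Q * (1 - P) := by
  have e : star Q = P * star Q * P + P * star Q * (1 - P) + (1 - P) * star Q * P
      + (1 - P) * star Q * (1 - P) := by noncomm_ring
  rw [e, h.compress_left, h.off_diagonal, h.off_diagonal', h.compress_right]
  abel

theorem star_right_apply_of_fixed {x : H} (hx : P x = x) :
    (star Q) x = P (Q x) + P (Q x) - Q x := by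
  rw [h.star_right]
  change P (Q (P x)) - P (Q (x - P x)) - (Q (P x) - P (Q (P x)))
    + (Q (x - P x) - P (Q (x - P x))) = _
  rw [hx, sub_self, map_zero, map_zero]
  abel

theorem star_right_apply_of_null {x : H} (hx : P x = 0) :
    (star Q) x = Q x - P (Q x) - P (Q x) := by
  rw [h.star_right]
  change P (Q (P x)) - P (Q (x - P x)) - (Q (P x) - P (Q (P x)))
    + (Q (x - P x) - P (Q (x - P x))) = _
  rw [hx, sub_zero, map_zero, map_zero]
  abel

/-- If `Q = Q*`, the block equals its own negative. Conversely, the upper block is minus the adjoint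
of the lower one, so both vanish together and only the self-adjoint diagonal remains. -/
theorem lower_eq_zero_iff : (1 - P) * Q * P = 0 ↔ Q = star Q := by
  constructor
  · intro h0
    have h1 : P * Q * (1 - P) = 0 := by
      rw [← neg_eq_zero, ← h.star_lower, h0, star_zero]
    have e : Q = P * Q * P + P * Q * (1 - P) + (1 - P) * Q * P + (1 - P) * Q * (1 - P) := by
      noncomm_ring
    rw [h.star_right, h0, h1]
    rw [h0, h1] at e
    simpa using e
  · intro hs
    have := h.off_diagonal'
    rw [← hs] at this
    have h2 : (2 : ℂ) • ((1 - P) * Q * P) = 0 := by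
      rw [two_smul]; nth_rewrite 1 [this]; exact neg_add_cancel _
    exact (smul_eq_zero.1 h2).resolve_left two_ne_zero

theorem upper_eq_zero_iff : P * Q * (1 - P) = 0 ↔ (1 - P) * Q * P = 0 := by
  rw [← neg_eq_zero, ← h.star_lower, star_eq_zero]

theorem left_of_mem_H₅ {y : H} (hy : y ∈ (H₅ P Q).toSubmodule) : P y = y :=
  ClosedSub.closedRange_induction (T := P * Q * (1 - P)) (p := fun y => P y = y)
    (isClosed_eq P.toCLM.continuous continuous_id) (fun _ => h.left_left _) hy

theorem left_of_mem_H₆ {y : H} (hy : y ∈ (H₆ P Q).toSubmodule) : P y = 0 := by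
  refine ClosedSub.closedRange_induction (p := fun y => P y = 0)
    (isClosed_eq P.toCLM.continuous continuous_const) (fun x => ?_) hy
  change P (Q (P x) - P (Q (P x))) = 0
  rw [map_sub, h.left_left, sub_self]

theorem mem_H₅_of_null {y : H} (hy : P y = 0) : P (Q y) ∈ (H₅ P Q).toSubmodule := by
  have := ClosedSub.apply_mem_closedRange (P * Q * (1 - P)) y
  change P (Q (y - P y)) ∈ _ at this
  rwa [hy, sub_zero] at this

theorem mem_H₆_of_fixed {y : H} (hy : P y = y) : Q y - P (Q y) ∈ (H₆ P Q).toSubmodule := by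
  have := ClosedSub.apply_mem_closedRange ((1 - P) * Q * P) y
  change Q (P y) - P (Q (P y)) ∈ _ at this
  rwa [hy] at this

/-- Idempotency gives `PQ·PQ(1-P) = PQ(1-P)·(1 - Q(1-P))`, so `PQ` preserves the range of `PQ(1-P)`,
and by continuity its closure. -/
theorem mem_H₅_of_mem_H₅ {y : H} (hy : y ∈ (H₅ P Q).toSubmodule) :
    P (Q y) ∈ (H₅ P Q).toSubmodule := by
  refine ClosedSub.closedRange_induction (p := fun y => P (Q y) ∈ (H₅ P Q).toSubmodule)
    ((H₅ P Q).isClosed.preimage (P.toCLM.continuous.comp Q.toCLM.continuous)) (fun x => ?_) hy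
  have e : P (Q (P (Q (x - P x)))) = (P * Q * (1 - P)) (x - Q (x - P x)) := by
    change _ = P (Q ((x - Q (x - P x)) - P (x - Q (x - P x))))
    simp only [map_sub, h.right_right]
    abel
  change P (Q (P (Q (x - P x)))) ∈ _
  rw [e]
  exact ClosedSub.apply_mem_closedRange _ _

/-- The mirror identity is `(1-P)Q·(1-P)QP = (1-P)QP·(1 - QP)`. -/
theorem mem_H₆_of_mem_H₆ {y : H} (hy : y ∈ (H₆ P Q).toSubmodule) :
    Q y - P (Q y) ∈ (H₆ P Q).toSubmodule := by
  refine ClosedSub.closedRange_induction (p := fun y => Q y - P (Q y) ∈ (H₆ P Q).toSubmodule)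
    ((H₆ P Q).isClosed.preimage
      (Q.toCLM.continuous.sub (P.toCLM.continuous.comp Q.toCLM.continuous))) (fun x => ?_) hy
  have e : Q (Q (P x) - P (Q (P x))) - P (Q (Q (P x) - P (Q (P x))))
      = ((1 - P) * Q * P) (x - Q (P x)) := by
    change _ = Q (P (x - Q (P x))) - P (Q (P (x - Q (P x))))
    simp only [map_sub, h.right_right]
  change Q (Q (P x) - P (Q (P x))) - P (Q (Q (P x) - P (Q (P x)))) ∈ _
  rw [e]
  exact ClosedSub.apply_mem_closedRange _ _

theorem inner_H₅_eq_zero {x y : H} (hx : P x = x) (hQx : P (Q x) = Q x)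
    (hy : y ∈ (H₅ P Q).toSubmodule) : inner A x y = 0 := by
  refine ClosedSub.closedRange_induction (p := fun y => inner A x y = 0)
    (isClosed_eq (CStarModule.continuous_inner.comp (continuous_const.prodMk continuous_id))
      continuous_const) (fun w => ?_) hy
  rw [inner_star_left, h.star_upper]
  change inner A (-(Q (P x) - P (Q (P x)))) w = 0
  rw [hx, hQx, sub_self, neg_zero, CStarModule.inner_zero_left]

theorem inner_H₆_eq_zero {x y : H} (hx : P x = 0) (hQx : P (Q x) = 0)
    (hy : y ∈ (H₆ P Q).toSubmodule) : inner A x y = 0 := by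
  refine ClosedSub.closedRange_induction (p := fun y => inner A x y = 0)
    (isClosed_eq (CStarModule.continuous_inner.comp (continuous_const.prodMk continuous_id))
      continuous_const) (fun w => ?_) hy
  rw [inner_star_left, h.star_lower]
  change inner A (-(P (Q (x - P x)))) w = 0
  rw [hx, sub_zero, hQx, neg_zero, CStarModule.inner_zero_left]

/-- Orthogonality to the range of `PQ(1-P)` means being killed by its adjoint `-(1-P)QP`. -/
theorem apply_of_orth_H₅ {x : H} (hx : P x = x)
    (ho : ∀ z ∈ (H₅ P Q).toSubmodule, inner A z x = 0) : P (Q x) = Q x := by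
  have : (star (P * Q * (1 - P))) x = 0 := eq_of_inner (A := A) fun z => by
    rw [← inner_star_right, ho _ (ClosedSub.apply_mem_closedRange _ z),
      CStarModule.inner_zero_right]
  rw [h.star_upper] at this
  change -(Q (P x) - P (Q (P x))) = 0 at this
  rw [hx, neg_eq_zero, sub_eq_zero] at this
  exact this.symm

theorem apply_of_orth_H₆ {x : H} (hx : P x = 0)
    (ho : ∀ z ∈ (H₆ P Q).toSubmodule, inner A z x = 0) : P (Q x) = 0 := by
  have : (star ((1 - P) * Q * P)) x = 0 := eq_of_inner (A := A) fun z => by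
    rw [← inner_star_right, ho _ (ClosedSub.apply_mem_closedRange _ z),
      CStarModule.inner_zero_right]
  rw [h.star_lower] at this
  change -(P (Q (x - P x))) = 0 at this
  rwa [hx, neg_eq_zero, sub_zero] at this

end IsQuasiProjectionPair

/-! ### The six-fold orthogonal decomposition -/

section SixSub

variable {P Q : Adjointable A H H} (hP : IsIdempotentElem P) (hQ : IsIdempotentElem Q)

theorem sixSub_left (h : IsQuasiProjectionPair P Q) (j : Fin 6) {y : H}
    (hy : y ∈ (sixSub P Q hP hQ j).toSubmodule) :
    P y = if j = 0 ∨ j = 1 ∨ j = 4 then y else 0 := by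
  fin_cases j
  · exact (mem_H₁.1 hy).1
  · exact (mem_H₂.1 hy).1
  · exact (mem_H₃.1 hy).1
  · exact (mem_H₄.1 hy).1
  · exact h.left_of_mem_H₅ hy
  · exact h.left_of_mem_H₆ hy

theorem sixSub_right {j : Fin 6} (hj : j < 4) {y : H}
    (hy : y ∈ (sixSub P Q hP hQ j).toSubmodule) :
    Q y = if j = 0 ∨ j = 2 then y else 0 := by
  fin_cases j
  · exact (mem_H₁.1 hy).2
  · exact (mem_H₂.1 hy).2
  · exact (mem_H₃.1 hy).2
  · exact (mem_H₄.1 hy).2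
  all_goals exact absurd hj (by decide)

/-- On the first four summands `Q` acts as 0 or 1, so it has no off-diagonal part there and the sign
change is invisible. -/
theorem sixSub_star_right (h : IsQuasiProjectionPair P Q) {j : Fin 6} (hj : j < 4) {y : H}
    (hy : y ∈ (sixSub P Q hP hQ j).toSubmodule) : (star Q) y = Q y := by
  have h1 := sixSub_left hP hQ h j hy
  have h2 := sixSub_right hP hQ hj hy
  by_cases hc : j = 0 ∨ j = 1 ∨ j = 4
  · rw [if_pos hc] at h1
    rw [h.star_right_apply_of_fixed h1, h2]
    split_ifs <;> simp [h1]
  · rw [if_neg hc] at h1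
    rw [h.star_right_apply_of_null h1, h2]
    split_ifs <;> simp [h1]

theorem sixSub_inner_eq_zero (h : IsQuasiProjectionPair P Q) (i j : Fin 6) (hij : i ≠ j) :
    ∀ x ∈ (sixSub P Q hP hQ i).toSubmodule, ∀ y ∈ (sixSub P Q hP hQ j).toSubmodule,
      inner A x y = 0 := by
  wlog hlt : i < j generalizing i j
  · intro x hx y hy
    rw [← CStarModule.star_inner, this j i hij.symm (lt_of_le_of_ne (not_lt.1 hlt) hij.symm)
      y hy x hx, star_zero]
  intro x hx y hy
  have hPx := sixSub_left hP hQ h i hx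
  have hPy := sixSub_left hP hQ h j hy
  have hPP := h.inner_left x y
  by_cases hj : j < 4
  · have hi := hlt.trans hj
    have hQx := sixSub_right hP hQ hi hx
    have hQy := sixSub_right hP hQ hj hy
    have hQQ := inner_star_left Q y x
    rw [sixSub_star_right hP hQ h hi hx] at hQQ
    rw [hPx, hPy] at hPP
    rw [hQx, hQy] at hQQ
    -- Any two of `H₁, …, H₄` carry different eigenvalues (0 or 1) of `P` or of `Q`, and both act
    -- symmetrically there.
    fin_cases i <;> fin_cases j <;> simp_all
  · have hji : j = 4 ∨ j = 5 := by
      clear * - hj; revert hj; revert j; decide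
    rcases hji with rfl | rfl
    · have hi : i < 4 := hlt
      -- Either `P` takes different values on the two summands, or both lie in `𝓡(P)` and the
      -- adjoint of the upper block kills `x`.
      by_cases hc : i = 0 ∨ i = 1 ∨ i = 4
      · rw [if_pos hc] at hPx
        refine h.inner_H₅_eq_zero hPx ?_ hy
        rw [sixSub_right hP hQ hi hx]
        split_ifs <;> simp [hPx]
      · rw [if_neg hc] at hPx
        rw [hPx, hPy] at hPP
        simpa using hPP.symm
    · by_cases hc : i = 0 ∨ i = 1 ∨ i = 4
      · rw [if_pos hc] at hPx
        rw [hPx, hPy] at hPP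
        simpa using hPP
      · rw [if_neg hc] at hPx
        have hi : i < 4 := by
          clear * - hlt hc; revert hlt hc; revert i; decide
        refine h.inner_H₆_eq_zero hPx ?_ hy
        rw [sixSub_right hP hQ hi hx]
        split_ifs <;> simp [hPx]

theorem sixSub_exists_sum (h : IsHarmonious P Q) (x : H) :
    ∃ y : ∀ i, (sixSub P Q hP hQ i).toSubmodule, x = ∑ i, (y i : H) := by
  have hq := h.toIsQuasiProjectionPair
  set y₅ := ClosedSub.proj h.isOrthComplemented_H₅ (P x) with hy₅
  set y₆ := ClosedSub.proj h.isOrthComplemented_H₆ (x - P x) with hy₆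
  set u : H := P x - y₅ with hu
  set v : H := (x - P x) - y₆ with hv
  have hPu : P u = u := by rw [hu, map_sub, hq.left_left, hq.left_of_mem_H₅ y₅.2]
  have hPv : P v = 0 := by
    rw [hv, map_sub, map_sub, hq.left_left, hq.left_of_mem_H₆ y₆.2]; simp
  have hQu : P (Q u) = Q u := hq.apply_of_orth_H₅ hPu fun z hz => ClosedSub.inner_sub_proj _ _ hz
  have hQv : P (Q v) = 0 := hq.apply_of_orth_H₆ hPv fun z hz => ClosedSub.inner_sub_proj _ _ hz
  refine ⟨fun
    | 0 => ⟨Q u, mem_H₁.2 ⟨hQu, hq.right_right u⟩⟩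
    | 1 => ⟨u - Q u, mem_H₂.2 ⟨by rw [map_sub, hPu, hQu], by rw [map_sub, hq.right_right, sub_self]⟩⟩
    | 2 => ⟨Q v, mem_H₃.2 ⟨hQv, hq.right_right v⟩⟩
    | 3 => ⟨v - Q v, mem_H₄.2 ⟨by rw [map_sub, hPv, hQv, sub_self],
        by rw [map_sub, hq.right_right, sub_self]⟩⟩
    | 4 => y₅
    | 5 => y₆, ?_⟩
  rw [Fin.sum_univ_six]
  change x = Q u + (u - Q u) + Q v + (v - Q v) + y₅ + y₆
  rw [hu, hv]
  abel

end SixSub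

/-! ### The corners of `Q` on `H₅ ⊕ H₆` -/

theorem Adjointable.commute_ell [CompleteSpace H] (a : Adjointable A H H) :
    Commute a a.ell := by
  have hc : Commute (a ^ 2 - a) a := ((Commute.refl a).pow_left 2).sub_left (Commute.refl a)
  exact (Commute.cfcₙ_nnreal hc NNReal.sqrt).symm

theorem Adjointable.ell_mul_ell [CompleteSpace H] (a : Adjointable A H H) (h : 0 ≤ a ^ 2 - a) :
    a.ell * a.ell = a ^ 2 - a := CFC.sqrt_mul_sqrt_self _ h

theorem Adjointable.star_ell [CompleteSpace H] (a : Adjointable A H H) : star a.ell = a.ell :=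
  IsSelfAdjoint.of_nonneg (CFC.sqrt_nonneg _)

namespace IsHarmonious

variable {P Q : Adjointable A H H} (h : IsHarmonious P Q)

/-- The compression of `Q` to `H₅`. -/
def corner₅₅ : Adjointable A (H₅ P Q).toSubmodule (H₅ P Q).toSubmodule :=
  (ClosedSub.proj h.isOrthComplemented_H₅).comp
    (Q.comp (ClosedSub.proj h.isOrthComplemented_H₅).adjoint)

/-- The corner of `Q` from `H₆` to `H₅`. -/
def corner₅₆ : Adjointable A (H₆ P Q).toSubmodule (H₅ P Q).toSubmodule :=
  (ClosedSub.proj h.isOrthComplemented_H₅).comp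
    (Q.comp (ClosedSub.proj h.isOrthComplemented_H₆).adjoint)

/-- The corner of `Q` from `H₅` to `H₆`. -/
def corner₆₅ : Adjointable A (H₅ P Q).toSubmodule (H₆ P Q).toSubmodule :=
  (ClosedSub.proj h.isOrthComplemented_H₆).comp
    (Q.comp (ClosedSub.proj h.isOrthComplemented_H₅).adjoint)

/-- The compression of `Q` to `H₆`. -/
def corner₆₆ : Adjointable A (H₆ P Q).toSubmodule (H₆ P Q).toSubmodule :=
  (ClosedSub.proj h.isOrthComplemented_H₆).comp
    (Q.comp (ClosedSub.proj h.isOrthComplemented_H₆).adjoint)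

include h

theorem proj₅_left (x : H) : ClosedSub.proj h.isOrthComplemented_H₅ (P x) =
    ClosedSub.proj h.isOrthComplemented_H₅ x :=
  ClosedSub.proj_eq_of_forall_inner _ fun z => by
    rw [← h.inner_left, h.left_of_mem_H₅ z.2]
    exact (ClosedSub.inner_projFun' h.isOrthComplemented_H₅ x z).symm

theorem proj₆_left (x : H) : ClosedSub.proj h.isOrthComplemented_H₆ (P x) = 0 :=
  ClosedSub.proj_eq_zero _ fun z hz => by
    rw [← h.inner_left, h.left_of_mem_H₆ hz, CStarModule.inner_zero_left]

theorem coe_corner₅₅ (y : (H₅ P Q).toSubmodule) : (h.corner₅₅ y : H) = P (Q y) := by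
  change (ClosedSub.proj h.isOrthComplemented_H₅ (Q y) : H) = _
  rw [← h.proj₅_left, ClosedSub.coe_proj_of_mem _ (h.mem_H₅_of_mem_H₅ y.2)]

theorem coe_corner₅₆ (y : (H₆ P Q).toSubmodule) : (h.corner₅₆ y : H) = P (Q y) := by
  change (ClosedSub.proj h.isOrthComplemented_H₅ (Q y) : H) = _
  rw [← h.proj₅_left, ClosedSub.coe_proj_of_mem _ (h.mem_H₅_of_null (h.left_of_mem_H₆ y.2))]

theorem proj₆_sub (x : H) : ClosedSub.proj h.isOrthComplemented_H₆ (x - P x) =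
    ClosedSub.proj h.isOrthComplemented_H₆ x := by
  rw [map_sub, h.proj₆_left, sub_zero]

theorem coe_corner₆₅ (y : (H₅ P Q).toSubmodule) : (h.corner₆₅ y : H) = Q y - P (Q y) := by
  change (ClosedSub.proj h.isOrthComplemented_H₆ (Q y) : H) = _
  rw [← h.proj₆_sub, ClosedSub.coe_proj_of_mem _ (h.mem_H₆_of_fixed (h.left_of_mem_H₅ y.2))]

theorem coe_corner₆₆ (y : (H₆ P Q).toSubmodule) : (h.corner₆₆ y : H) = Q y - P (Q y) := by
  change (ClosedSub.proj h.isOrthComplemented_H₆ (Q y) : H) = _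
  rw [← h.proj₆_sub, ClosedSub.coe_proj_of_mem _ (h.mem_H₆_of_mem_H₆ y.2)]

theorem isSelfAdjoint_corner₅₅ : IsSelfAdjoint h.corner₅₅ := by
  refine Adjointable.ext fun y => ?_
  change ClosedSub.proj h.isOrthComplemented_H₅ ((star Q) y) =
    ClosedSub.proj h.isOrthComplemented_H₅ (Q y)
  rw [h.star_right_apply_of_fixed (h.left_of_mem_H₅ y.2), map_sub, map_add, h.proj₅_left,
    add_sub_cancel_right]

theorem adjoint_corner₆₅ : h.corner₆₅.adjoint = -h.corner₅₆ := by
  refine Adjointable.ext fun y => ?_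
  change ClosedSub.proj h.isOrthComplemented_H₅ ((star Q) y) =
    -ClosedSub.proj h.isOrthComplemented_H₅ (Q y)
  rw [h.star_right_apply_of_null (h.left_of_mem_H₆ y.2), map_sub, map_sub, h.proj₅_left,
    sub_self, zero_sub]

/-- The `P`-`P` block of `Q² = Q` reads `(PQP)² - PQP = -PQ(1-P)QP`, and the sign rule turns the
right side into `TT*` with `T = PQ(1-P)`. -/
theorem coe_corner₅₅_sq_sub (y : (H₅ P Q).toSubmodule) :
    ((h.corner₅₅ ^ 2 - h.corner₅₅) y : H) =
      (P * Q * (1 - P) * star (P * Q * (1 - P))) y := by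
  rw [h.star_upper, sq]
  change ((h.corner₅₅ (h.corner₅₅ y) : H) - (h.corner₅₅ y : H)) =
    P (Q (-(Q (P y) - P (Q (P y))) - P (-(Q (P y) - P (Q (P y))))))
  rw [h.coe_corner₅₅, h.coe_corner₅₅, h.left_of_mem_H₅ y.2]
  simp only [map_sub, map_neg, h.left_left, h.right_right]
  abel

theorem adjoint_comp_corner₆₅ :
    h.corner₆₅.adjoint.comp h.corner₆₅ = h.corner₅₅ ^ 2 - h.corner₅₅ := by
  refine Adjointable.ext fun y => Subtype.ext ?_
  rw [h.adjoint_corner₆₅, sq]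
  change -(h.corner₅₆ (h.corner₆₅ y) : H) =
    (h.corner₅₅ (h.corner₅₅ y) : H) - (h.corner₅₅ y : H)
  rw [h.coe_corner₅₆, h.coe_corner₆₅, h.coe_corner₅₅, h.coe_corner₅₅]
  simp only [map_sub, h.right_right]
  abel

/-- This is the lower-left block of `Q² = Q`; it determines the `H₆` corner on a dense range. -/
theorem corner₆₆_comp_corner₆₅ :
    h.corner₆₆.comp h.corner₆₅ = h.corner₆₅.comp (1 - h.corner₅₅) := by
  refine Adjointable.ext fun y => Subtype.ext ?_
  rw [comp_apply, comp_apply, h.coe_corner₆₆, h.coe_corner₆₅, h.coe_corner₆₅]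
  change _ = Q (y - (h.corner₅₅ y : H)) - P (Q (y - (h.corner₅₅ y : H)))
  rw [h.coe_corner₅₅]
  simp only [map_sub, h.right_right]

variable [CompleteSpace H]

theorem corner₅₅_sq_sub_nonneg : 0 ≤ h.corner₅₅ ^ 2 - h.corner₅₅ := by
  have e : h.corner₅₅ ^ 2 - h.corner₅₅ = (ClosedSub.proj h.isOrthComplemented_H₅).comp
      ((P * Q * (1 - P) * star (P * Q * (1 - P))).comp
        (ClosedSub.proj h.isOrthComplemented_H₅).adjoint) := by
    refine Adjointable.ext fun y => ?_
    rw [← ClosedSub.proj_coe h.isOrthComplemented_H₅ ((h.corner₅₅ ^ 2 - h.corner₅₅) y),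
      h.coe_corner₅₅_sq_sub]
    rfl
  rw [e]
  exact ClosedSub.compress_nonneg _ (mul_star_self_nonneg _) fun x =>
    ClosedSub.apply_mem_closedRange _ _

theorem denseRange_corner₅₅_sq_sub : DenseRange (h.corner₅₅ ^ 2 - h.corner₅₅).toCLM := by
  refine ClosedSub.denseRange_of_mul_star (T := P * Q * (1 - P)) _ fun x =>
    ⟨ClosedSub.proj h.isOrthComplemented_H₅ x, ?_⟩
  rw [h.coe_corner₅₅_sq_sub]
  -- `T*` vanishes on the complement of `H₅`, so projecting `x` onto `H₅` does not change `TT*x`.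
  refine congrArg (P * Q * (1 - P)).toCLM (eq_of_inner (A := A) fun z => ?_)
  refine (inner_star_right (P * Q * (1 - P)) _ _).symm.trans
    (Eq.trans ?_ (inner_star_right (P * Q * (1 - P)) _ _))
  rw [eq_comm, ← sub_eq_zero, ← CStarModule.inner_sub_right]
  exact ClosedSub.inner_sub_proj _ _ (ClosedSub.apply_mem_closedRange _ _)

theorem denseRange_corner₆₅ : DenseRange h.corner₆₅.toCLM := by
  refine ClosedSub.denseRange_of_mul_star (T := (1 - P) * Q * P) _ fun x =>
    -- The witness is `((1-P)QP)* x = -PQ(1-P)x`, which already lies in `H₅`.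
    ⟨-⟨(P * Q * (1 - P)) x, ClosedSub.apply_mem_closedRange _ x⟩, ?_⟩
  rw [h.coe_corner₆₅, h.star_lower]
  change Q (-(P (Q (x - P x)))) - P (Q (-(P (Q (x - P x)))))
    = Q (P (-(P (Q (x - P x))))) - P (Q (P (-(P (Q (x - P x))))))
  rw [map_neg P.toCLM, h.left_left]

theorem exists_isUnitary_corner : ∃ U : Adjointable A (H₅ P Q).toSubmodule (H₆ P Q).toSubmodule,
    U.IsUnitary ∧ h.corner₆₅ = U.comp h.corner₅₅.ell ∧
      h.corner₅₆ = (-h.corner₅₅.ell).comp U.adjoint ∧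
      h.corner₆₆ = U.comp ((1 - h.corner₅₅).comp U.adjoint) := by
  set a := h.corner₅₅ with ha
  have hnn : 0 ≤ a ^ 2 - a := h.corner₅₅_sq_sub_nonneg
  -- The range of `ℓ(a)` contains that of `ℓ(a)² = a² - a`.
  have hd : DenseRange a.ell.toCLM := by
    refine h.denseRange_corner₅₅_sq_sub.mono ?_
    rintro _ ⟨y, rfl⟩
    exact ⟨a.ell y, congrArg (fun T : Adjointable A _ _ => T y) (a.ell_mul_ell hnn)⟩
  obtain ⟨U, hU, hUl⟩ := exists_isUnitary_comp_eq a.ell h.corner₆₅ hd h.denseRange_corner₆₅ (by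
    rw [h.adjoint_comp_corner₆₅, ← ha, ← a.ell_mul_ell hnn]
    exact congrArg (· * a.ell) a.star_ell)
  have hl : a.ell.adjoint = a.ell := a.star_ell
  refine ⟨U, hU, hUl.symm, ?_, ?_⟩
  · have h1 := h.adjoint_corner₆₅
    rw [← hUl, adjoint_comp, hl] at h1
    rw [← neg_neg h.corner₅₆, ← h1]
    exact Adjointable.ext fun _ => rfl
  -- It suffices to compare on the dense range of `ℓ(a)`, where `U ℓ(a)` is the lower-left corner
  -- and `ℓ(a)` commutes with `a`.
  · have h2 : h.corner₆₆.comp U = U.comp (1 - a) := by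
      refine Adjointable.ext fun x => ?_
      refine hd.induction_on (p := fun x => (h.corner₆₆.comp U) x = (U.comp (1 - a)) x) x
        (isClosed_eq (ContinuousLinearMap.continuous _) (ContinuousLinearMap.continuous _))
        fun x => ?_
      change ((h.corner₆₆.comp (U.comp a.ell))) x = (U.comp ((1 - a) * a.ell)) x
      have h3 : (1 - a) * a.ell = a.ell * (1 - a) :=
        ((Commute.one_left _).sub_left a.commute_ell).eq
      rw [hUl, h3, h.corner₆₆_comp_corner₆₅, ← hUl]
      rfl
    rw [← comp_assoc, ← h2, comp_assoc, hU.2]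
    rfl

end IsHarmonious

end

end HilbertMod

end

/-! ### Assembly of the block matrices -/

theorem mainTheorem2 {A : Type*} [NonUnitalCStarAlgebra A] [PartialOrder A] [StarOrderedRing A]
    {H : Type*} [NormedAddCommGroup H] [NormedSpace ℂ H] [CompleteSpace H] [SMul A H]
    [CStarModule A H] (P Q : Adjointable A H H)
    (hPQ : IsHarmonious P Q) (hP0 : P ≠ 0) (hP1 : P ≠ 1) :
    -- `H₅ ≠ {0}` iff `H₆ ≠ {0}` iff `Q ≠ Q*`
    ((H₅ P Q).toSubmodule ≠ ⊥ ↔ (H₆ P Q).toSubmodule ≠ ⊥) ∧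
    ((H₆ P Q).toSubmodule ≠ ⊥ ↔ Q ≠ star Q) ∧
    -- the unitary `U_{P,Q} : H → H₁ ⊕ ⋯ ⊕ H₆`, `x ↦ (P₁ x, …, P₆ x)`, exists
    ∃ hM : ∀ i, (sixSub P Q hPQ.isStarProjection.isIdempotentElem
        hPQ.isIdempotentElem i).IsOrthComplemented,
      (toDirectSum hM).IsUnitary ∧
      -- the block matrix representations
      (Q ≠ star Q →
        (toDirectSum hM).comp (P.comp (toDirectSum hM).adjoint) =
          blockMatrix (blocksP P Q hPQ.isStarProjection.isIdempotentElem
            hPQ.isIdempotentElem) ∧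
        ∃ (a : Adjointable A (H₅ P Q).toSubmodule
              (H₅ P Q).toSubmodule)
          (U : Adjointable A (H₅ P Q).toSubmodule
              (H₆ P Q).toSubmodule),
          IsSelfAdjoint a ∧ 0 ≤ a ^ 2 - a ∧ DenseRange (a ^ 2 - a).toCLM ∧ U.IsUnitary ∧
          (toDirectSum hM).comp (Q.comp (toDirectSum hM).adjoint) =
            blockMatrix (blocksQ P Q
              hPQ.isStarProjection.isIdempotentElem hPQ.isIdempotentElem a U)) := by
  have hq := hPQ.toIsQuasiProjectionPair
  have hP := hq.isStarProjection.isIdempotentElem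
  have hQ := hq.isIdempotentElem
  have h6 : (H₆ P Q).toSubmodule ≠ ⊥ ↔ Q ≠ star Q :=
    not_congr (ClosedSub.closedRange_eq_bot_iff.trans hq.lower_eq_zero_iff)
  have h56 : (H₅ P Q).toSubmodule ≠ ⊥ ↔ (H₆ P Q).toSubmodule ≠ ⊥ :=
    not_congr (ClosedSub.closedRange_eq_bot_iff.trans
      (hq.upper_eq_zero_iff.trans ClosedSub.closedRange_eq_bot_iff.symm))
  have horth := sixSub_inner_eq_zero hP hQ hq
  have hsum := sixSub_exists_sum hP hQ hPQ
  have hM := isOrthComplemented_of_sum horth hsum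
  refine ⟨h56, h6, hM, toDirectSum_isUnitary hM horth hsum, fun _ => ⟨?_, ?_⟩⟩
  · refine toDirectSum_comp_comp_adjoint hM P fun i j => ?_
    have hz : ∀ i j : Fin 6, i ≠ j ∨ ¬ (j = 0 ∨ j = 1 ∨ j = 4) →
        (ClosedSub.proj (hM i)).comp (P.comp (ClosedSub.proj (hM j)).adjoint) = 0 := by
      refine fun i j hij => ClosedSub.compress_eq_zero _ _ fun z hz y hy => ?_
      rw [sixSub_left hP hQ hq j hy]
      split_ifs with hc
      · exact horth i j (hij.resolve_right (not_not.2 hc)) z hz y hy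
      · exact CStarModule.inner_zero_right
    have ho : ∀ j : Fin 6, (j = 0 ∨ j = 1 ∨ j = 4) →
        (ClosedSub.proj (hM j)).comp (P.comp (ClosedSub.proj (hM j)).adjoint) = 1 :=
      fun j hj => ClosedSub.compress_eq_one _ fun y hy => by
        rw [sixSub_left hP hQ hq j hy, if_pos hj]
    fin_cases i <;> fin_cases j <;> first | exact hz _ _ (by decide) | exact ho _ (by decide)
  · obtain ⟨U, hU, h65, h5₆, h66⟩ := hPQ.exists_isUnitary_corner
    refine ⟨hPQ.corner₅₅, U, hPQ.isSelfAdjoint_corner₅₅, hPQ.corner₅₅_sq_sub_nonneg,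
      hPQ.denseRange_corner₅₅_sq_sub, hU, toDirectSum_comp_comp_adjoint hM Q fun i j => ?_⟩
    -- Columns below 4 use the action of `Q`; for the last two columns, rows below 4 vanish by
    -- moving `Q*` onto the left vector.
    have hz : ∀ i j : Fin 6, (j < 4 ∧ (i ≠ j ∨ ¬ (j = 0 ∨ j = 2))) ∨ (i < 4 ∧ 4 ≤ j) →
        (ClosedSub.proj (hM i)).comp (Q.comp (ClosedSub.proj (hM j)).adjoint) = 0 := by
      refine fun i j hij => ClosedSub.compress_eq_zero _ _ fun z hz y hy => ?_
      rcases hij with ⟨hj, hij⟩ | ⟨hi, hj⟩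
      · rw [sixSub_right hP hQ hj hy]
        split_ifs with hc
        · exact horth i j (hij.resolve_right (not_not.2 hc)) z hz y hy
        · exact CStarModule.inner_zero_right
      · rw [Adjointable.inner_star_left, sixSub_star_right hP hQ hq hi hz,
          sixSub_right hP hQ hi hz]
        split_ifs with hc
        · exact horth i j (hi.trans_le hj).ne z hz y hy
        · exact CStarModule.inner_zero_left
    have ho : ∀ j : Fin 6, (j = 0 ∨ j = 2) →
        (ClosedSub.proj (hM j)).comp (Q.comp (ClosedSub.proj (hM j)).adjoint) = 1 :=
      fun j hj => ClosedSub.compress_eq_one _ fun y hy => by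
        rw [sixSub_right hP hQ (by rcases hj with rfl | rfl <;> decide) hy, if_pos hj]
    -- Beyond the scalar blocks only the `2 × 2` corner is left; its `H₅` diagonal entry holds by
    -- definition.
    fin_cases i <;> fin_cases j <;>
      first
        | exact hz _ _ (by decide)
        | exact ho _ (by decide)
        | exact h65
        | exact h5₆
        | exact h66
        | rfl
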